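/- Let $q$ be an odd prime power and let $b\in\mathbb F_{q^6}^*$. Put $N=b^{q^3+1}$ and \[ \Delta_b=N^{2(q^2+q+1)}-2\left(N^{q^2+q+2}+N^{q^2+2q+1}+N^{2q^2+q+1}\right)+N^2+N^{2q}+N^{2q^2}+8N^{q^2+q+1}-2\left(N^{q+1}+N^{q^2+q}+N^{q^2+1}\right). \] Then $\Delta_b$ is the discriminant of the quadratic polynomial \[ \phi_b(T)=b^{q+1}T^2+\left(-b^{q^5+q^4+q^3+q^2+q+1}+2b^{q^4+q^3+q+1}-b^{q^3+1}-b^{q^4+q}+b^{q^5+q^2}\right)T-b^{q^3+q^4}\left(b^{q^3+1}-1\right)^{1+q+q^2}\in\mathbb F_{q^6}[T], \] one has $\Delta_b\in\mathbb F_q$, and the $\mathbb F_q$-subspace \[ U_b=\{(x,\;b x^q+x^{q^4}) : x\in\mathbb F_{q^6}\} \] of $V=\mathbb F_{q^6}\times\mathbb F_{q^6}$ is maximum scattered if and only if $\Delta_b$ is a nonzero square in $\mathbb F_q$ (that is, $\Delta_b=c^2$ for some $c\in\mathbb F_q^*$). Here an $\mathbb F_q$-subspace $U$ of $V$ is called scattered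 if $\dim_{\mathbb F_q}(U\cap\langle v\rangle_{\mathbb F_{q^6}})\le 1$ for every nonzero $v\in V$, and maximum scattered if moreover $\dim_{\mathbb F_q}U=\tfrac12\dim_{\mathbb F_q}V=6$. -/

import Mathlib

/-- The Desarguesian spread of an `L`-vector space `V`, viewed over the subfield `K` of `L`: its
elements are the one-dimensional `L`-subspaces `⟨v⟩_L` (`v ≠ 0`), regarded as `K`-subspaces. -/
def desarguesianSpread (K L V : Type*) [Field K] [Field L] [Algebra K L] [AddCommGroup V]
    [Module K V] [Module L V] [IsScalarTower K L V] : Set (Submodule K V) :=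
  {W | ∃ v : V, v ≠ 0 ∧ W = (Submodule.span L {v}).restrictScalars K}

/-- A `K`-subspace `U` of `V` is scattered (with respect to the Desarguesian spread) if it meets
every spread element in a `K`-subspace of dimension at most one. -/
def IsScattered (K L : Type*) {V : Type*} [Field K] [Field L] [Algebra K L] [AddCommGroup V]
    [Module K V] [Module L V] [IsScalarTower K L V] (U : Submodule K V) : Prop :=
  ∀ W ∈ desarguesianSpread K L V, Module.rank K ↥(U ⊓ W) ≤ 1

/-- A scattered subspace of `V` is maximum scattered if its `K`-dimension is half of the
`K`-dimension of `V` (that is, `r n / 2` if `V` has dimension `r` over `L` and `[L : K] = n`). -/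
def IsMaximumScattered (K L : Type*) {V : Type*} [Field K] [Field L] [Algebra K L]
    [AddCommGroup V] [Module K V] [Module L V] [IsScalarTower K L V] (U : Submodule K V) : Prop :=
  IsScattered K L U ∧ 2 * Module.finrank K U = Module.finrank K V

/-- The `q ^ i`-power map, `q = |K|`, is additive on a `K`-algebra. -/
theorem add_pow_card_pow (K : Type*) {L : Type*} [Field K] [Fintype K] [Field L] [Algebra K L]
    (i : ℕ) (x y : L) :
    (x + y) ^ Fintype.card K ^ i = x ^ Fintype.card K ^ i + y ^ Fintype.card K ^ i := by
  induction i generalizing x y with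
  | zero => simp
  | succ n ih =>
    have h : ∀ a b : L, (a + b) ^ Fintype.card K = a ^ Fintype.card K + b ^ Fintype.card K :=
      fun a b => map_add (FiniteField.frobeniusAlgHom K L) a b
    rw [pow_succ, pow_mul, ih, h, ← pow_mul, ← pow_mul]

/-- The `q ^ i`-power map, `q = |K|`, commutes with scalars of `K`. -/
theorem smul_pow_card_pow {K L : Type*} [Field K] [Fintype K] [Field L] [Algebra K L]
    (i : ℕ) (c : K) (x : L) :
    (c • x) ^ Fintype.card K ^ i = c • x ^ Fintype.card K ^ i := by
  rw [smul_pow, FiniteField.pow_card_pow]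

/-- The `K`-subspace `U_b = {(x, b x^q + x^(q^4)) : x ∈ L}` of `L × L`, where `q = |K|`. -/
def subspaceU (K : Type*) {L : Type*} [Field K] [Fintype K] [Field L] [Algebra K L] (b : L) :
    Submodule K (L × L) where
  carrier := {p | ∃ x : L, p = (x, b * x ^ Fintype.card K + x ^ Fintype.card K ^ 4)}
  zero_mem' := ⟨0, by simp [Fintype.card_ne_zero, Prod.ext_iff]⟩
  add_mem' := by
    rintro _ _ ⟨x, rfl⟩ ⟨y, rfl⟩
    refine ⟨x + y, ?_⟩
    have h1 := add_pow_card_pow K 1 x y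
    rw [pow_one] at h1
    rw [h1, add_pow_card_pow K 4 x y, Prod.mk_add_mk]
    congr 1
    ring
  smul_mem' := by
    rintro c _ ⟨x, rfl⟩
    refine ⟨c • x, ?_⟩
    have h1 := smul_pow_card_pow 1 c x
    rw [pow_one] at h1
    rw [h1, smul_pow_card_pow 4 c x, Prod.smul_mk, smul_add, mul_smul_comm]

/-- The quadratic polynomial `φ_b(T)` attached to `b` (and `q`). -/
noncomputable def phiPoly {L : Type*} [Field L] (q : ℕ) (b : L) : Polynomial L :=
  Polynomial.C (b ^ (q + 1)) * Polynomial.X ^ 2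
    + Polynomial.C (-b ^ (q ^ 5 + q ^ 4 + q ^ 3 + q ^ 2 + q + 1)
        + 2 * b ^ (q ^ 4 + q ^ 3 + q + 1) - b ^ (q ^ 3 + 1) - b ^ (q ^ 4 + q)
        + b ^ (q ^ 5 + q ^ 2)) * Polynomial.X
    - Polynomial.C (b ^ (q ^ 3 + q ^ 4) * (b ^ (q ^ 3 + 1) - 1) ^ (1 + q + q ^ 2))

/-- The norm `N = b^(q^3+1)` of `b` from the field of order `q^6` to its subfield of order
`q^3`. -/
def normB {L : Type*} [Field L] (q : ℕ) (b : L) : L := b ^ (q ^ 3 + 1)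

/-- The explicit expression `Δ_b`, in terms of `N = b^(q^3+1)`. -/
def deltaB {L : Type*} [Field L] (q : ℕ) (b : L) : L :=
  normB q b ^ (2 * (q ^ 2 + q + 1))
    - 2 * (normB q b ^ (q ^ 2 + q + 2) + normB q b ^ (q ^ 2 + 2 * q + 1)
        + normB q b ^ (2 * q ^ 2 + q + 1))
    + normB q b ^ 2 + normB q b ^ (2 * q) + normB q b ^ (2 * q ^ 2)
    + 8 * normB q b ^ (q ^ 2 + q + 1)
    - 2 * (normB q b ^ (q + 1) + normB q b ^ (q ^ 2 + q) + normB q b ^ (q ^ 2 + 1))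

/-!
Write `σ` for the `q`-power map of `L`, so that `σ⁶ = 1`, and `N = b σ³ b`, an element fixed by
`σ³`. The dimension of `U_b` is always six, so only scatteredness matters, and it fails exactly if
some `l ∈ L` outside `K` and some `x ≠ 0` satisfy `b σ(l x) + σ⁴(l x) = l (b σ x + σ⁴ x)`
(`isScattered_subspaceU_iff`).

Suppose that such `l` and `x` exist. Eliminating `x` shows that the pairs `{l, σ³ l}` and
`{σ l, σ⁴ l}` have cross-ratio `N`. The three conjugate pairs are the zeros of three binary
quadratic forms, and `Δ_b` is, up to a square factor, minus the determinant of the Gram matrix of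
these forms scaled to norm one (for `N ≠ 1`, when the pairs are not degenerate). In any case it is
the square of an explicit expression in the conjugates of `l` which `σ` negates
(`normDisc_mul_sq_of_crossRatio`, `normDisc_ne_sq_of_crossRatio`). In odd characteristic such a
square is not a nonzero square of an element of `K`.

Conversely, suppose that `Δ_b` is zero or a nonsquare in `K`, so that `Δ_b = δ²` with `σ δ = -δ`.
It suffices to find `m` such that `x ↦ b σ x + σ⁴ x - m x` has rank at most four, and for this that
its values satisfy a nonzero `q`-polynomial of `q`-degree at most four
(`LinearMap.finrank_le_of_annihilator`). If `N = 1`, then `m = 0` works. Otherwise the equation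
`b σ x + σ⁴ x = m x` and its image under `σ³` form an invertible semilinear system for the vector
`(x, σ³ x)`, and the three-fold iterate of this system has to be the interchange of coordinates.
This condition on `m` reduces to a quadratic equation with discriminant `Δ_b`; because `σ δ = -δ`,
its roots have the conjugates that Hilbert 90 requires (`exists_multiplier`,
`annihilator_of_multiplier`).
-/

/-! ### The discriminant, cross-ratios and a quadratic equation -/

/-- The polynomial in three variables whose value at `N, N^q, N^(q^2)` is `Δ_b`. It is written in
the elementary symmetric functions, so it is visibly symmetric; it is the discriminant of
`n₀ n₂ (1 - n₁) T² + (n₀ + n₂ - n₁ - n₀ n₁ n₂) T + (1 - n₁)`. -/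
def normDisc {R : Type*} [CommRing R] (n₀ n₁ n₂ : R) : R :=
  (n₀ * n₁ * n₂ - (n₀ + n₁ + n₂)) ^ 2 - 4 * (n₀ * n₁ + n₁ * n₂ + n₀ * n₂) + 8 * (n₀ * n₁ * n₂)

/-- If the pairs `{l₀, l₃}`, `{l₁, l₄}`, `{l₂, l₅}` have successive cross-ratios `n₀`, `n₁`, `n₂`,
then `normDisc n₀ n₁ n₂` is a square up to the square of a product of differences. The square root
is the determinant of the three binary quadratic forms with these pairs of zeros, times the product
of the three differences `lᵢ - lᵢ₊₃`. -/
theorem normDisc_mul_sq_of_crossRatio {R : Type*} [CommRing R] {n₀ n₁ n₂ l₀ l₁ l₂ l₃ l₄ l₅ : R}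
    (h₀ : n₀ * ((l₁ - l₀) * (l₄ - l₃)) = (l₄ - l₀) * (l₁ - l₃))
    (h₁ : n₁ * ((l₂ - l₁) * (l₅ - l₄)) = (l₅ - l₁) * (l₂ - l₄))
    (h₂ : n₂ * ((l₃ - l₂) * (l₀ - l₅)) = (l₀ - l₂) * (l₃ - l₅)) :
    normDisc n₀ n₁ n₂ *
        (((l₁ - l₀) * (l₄ - l₃)) * ((l₂ - l₁) * (l₅ - l₄)) * ((l₃ - l₂) * (l₀ - l₅))) ^ 2 =
      (((l₁ + l₄ - (l₀ + l₃)) * (l₂ * l₅ - l₀ * l₃) - (l₂ + l₅ - (l₀ + l₃)) * (l₁ * l₄ - l₀ * l₃)) *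
        ((l₀ - l₃) * (l₁ - l₄) * (l₂ - l₅))) ^ 2 := by
  have key : ∀ d₀ d₁ d₂ : R, normDisc n₀ n₁ n₂ * (d₀ * d₁ * d₂) ^ 2 =
      ((n₀ * d₀) * (n₁ * d₁) * (n₂ * d₂) - ((n₀ * d₀) * d₁ * d₂ + d₀ * (n₁ * d₁) * d₂
        + d₀ * d₁ * (n₂ * d₂))) ^ 2
      - 4 * ((n₀ * d₀) * (n₁ * d₁) * d₂ + d₀ * (n₁ * d₁) * (n₂ * d₂)
        + (n₀ * d₀) * d₁ * (n₂ * d₂)) * (d₀ * d₁ * d₂)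
      + 8 * ((n₀ * d₀) * (n₁ * d₁) * (n₂ * d₂)) * (d₀ * d₁ * d₂) := by
    intro d₀ d₁ d₂
    unfold normDisc
    ring
  rw [key, h₀, h₁, h₂]
  obtain ⟨a, rfl⟩ : ∃ a, l₁ = l₀ + a := ⟨l₁ - l₀, by ring⟩
  obtain ⟨b, rfl⟩ : ∃ a, l₂ = l₀ + a := ⟨l₂ - l₀, by ring⟩
  obtain ⟨c, rfl⟩ : ∃ a, l₃ = l₀ + a := ⟨l₃ - l₀, by ring⟩
  obtain ⟨d, rfl⟩ : ∃ a, l₄ = l₀ + a := ⟨l₄ - l₀, by ring⟩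
  obtain ⟨e, rfl⟩ : ∃ a, l₅ = l₀ + a := ⟨l₅ - l₀, by ring⟩
  have hE : (l₀ + a + (l₀ + d) - (l₀ + (l₀ + c))) * ((l₀ + b) * (l₀ + e) - l₀ * (l₀ + c))
      - (l₀ + b + (l₀ + e) - (l₀ + (l₀ + c))) * ((l₀ + a) * (l₀ + d) - l₀ * (l₀ + c))
      = (a + d - c) * (b * e) - (b + e - c) * (a * d) := by ring
  rw [hE]
  ring

section
variable {L : Type*} [Field L]

/-- A root of `n₀ n₂ (1 - n₁) T² + (n₀ + n₂ - n₁ - n₀ n₁ n₂) T + (1 - n₁)`, where `δ` is a square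
root of its discriminant `normDisc n₀ n₁ n₂`, and `2` and the leading coefficient are nonzero. -/
def discRoot (n₀ n₁ n₂ δ : L) : L :=
  (n₀ * n₁ * n₂ + n₁ - n₀ - n₂ + δ) / (2 * n₀ * n₂ * (1 - n₁))

/-- The Möbius map `t ↦ -(1 + t) / (1 + n₀ t)` carries a root of the quadratic to a root of its
cyclic shift, and changes the sign of the square root of the discriminant. -/
theorem discRoot_moebius {n₀ n₁ n₂ δ : L} (h2 : (2 : L) ≠ 0) (h0 : n₀ ≠ 0) (h1 : n₁ ≠ 0)
    (hn2 : n₂ ≠ 0) (h1' : 1 - n₁ ≠ 0) (h2' : 1 - n₂ ≠ 0) (hδ : δ ^ 2 = normDisc n₀ n₁ n₂) :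
    discRoot n₀ n₁ n₂ δ + discRoot n₁ n₂ n₀ (-δ) + 1 +
      n₀ * discRoot n₀ n₁ n₂ δ * discRoot n₁ n₂ n₀ (-δ) = 0 := by
  unfold normDisc at hδ
  unfold discRoot
  field_simp
  linear_combination -hδ

theorem mul_discRoot_mul_discRoot_neg {n₀ n₁ n₂ δ : L} (h2 : (2 : L) ≠ 0) (h0 : n₀ ≠ 0)
    (hn2 : n₂ ≠ 0) (h1' : 1 - n₁ ≠ 0) (hδ : δ ^ 2 = normDisc n₀ n₁ n₂) :
    n₀ * n₂ * (discRoot n₀ n₁ n₂ δ * discRoot n₀ n₁ n₂ (-δ)) = 1 := by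
  unfold normDisc at hδ
  unfold discRoot
  field_simp
  linear_combination -hδ

/-- With `σ` shifting the `nᵢ` and negating `δ`, this says that the quantity to be normalised in
`exists_multiplier` becomes fixed by `σ` after division by `(n - 1) (σ n - 1)`. -/
theorem discRoot_frobenius_quotient {n₀ n₁ n₂ δ : L} (h2 : (2 : L) ≠ 0) (h0 : n₀ ≠ 0) (h1 : n₁ ≠ 0)
    (hn2 : n₂ ≠ 0) (h0' : 1 - n₀ ≠ 0) (h1' : 1 - n₁ ≠ 0) (h2' : 1 - n₂ ≠ 0)
    (hδ : δ ^ 2 = normDisc n₀ n₁ n₂) :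
    n₂ * discRoot n₀ n₁ n₂ δ * (1 + discRoot n₂ n₀ n₁ δ) * (n₀ - 1) =
      (1 + discRoot n₁ n₂ n₀ (-δ)) * (n₂ - 1) := by
  unfold normDisc at hδ
  unfold discRoot
  field_simp
  linear_combination (n₀ - 1) * (1 - n₂) * hδ

end

/-! ### Consequences for a field with an endomorphism whose sixth power is the identity -/

section
variable {L : Type*} [Field L] (σ : L →+* L)

/-- If moreover an endomorphism `σ` permutes `l₀, …, l₅` cyclically, the determinant of the three
quadratic forms is fixed by `σ` (a 3-cycle is even), the product of the differences `lᵢ - lᵢ₊₃`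
changes sign, and the remaining product of differences is fixed. So the square root of `normDisc`
found in `normDisc_mul_sq_of_crossRatio` is negated by `σ` and cannot be a nonzero fixed element. -/
theorem normDisc_ne_sq_of_crossRatio (h2 : (2 : L) ≠ 0) {l₀ l₁ l₂ l₃ l₄ l₅ n₀ n₁ n₂ c : L}
    (s₀ : σ l₀ = l₁) (s₁ : σ l₁ = l₂) (s₂ : σ l₂ = l₃) (s₃ : σ l₃ = l₄) (s₄ : σ l₄ = l₅)
    (s₅ : σ l₅ = l₀)
    (h₀ : n₀ * ((l₁ - l₀) * (l₄ - l₃)) = (l₄ - l₀) * (l₁ - l₃))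
    (h₁ : n₁ * ((l₂ - l₁) * (l₅ - l₄)) = (l₅ - l₁) * (l₂ - l₄))
    (h₂ : n₂ * ((l₃ - l₂) * (l₀ - l₅)) = (l₀ - l₂) * (l₃ - l₅))
    (hl : l₁ ≠ l₀) (hc : σ c = c) (hc0 : c ≠ 0) : normDisc n₀ n₁ n₂ ≠ c ^ 2 := by
  intro hΔ
  have key := normDisc_mul_sq_of_crossRatio h₀ h₁ h₂
  obtain ⟨R, hR⟩ : ∃ R, R = ((l₁ - l₀) * (l₄ - l₃)) * ((l₂ - l₁) * (l₅ - l₄)) *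
      ((l₃ - l₂) * (l₀ - l₅)) := ⟨_, rfl⟩
  obtain ⟨P, hP⟩ : ∃ P, P = ((l₁ + l₄ - (l₀ + l₃)) * (l₂ * l₅ - l₀ * l₃) -
      (l₂ + l₅ - (l₀ + l₃)) * (l₁ * l₄ - l₀ * l₃)) *
        ((l₀ - l₃) * (l₁ - l₄) * (l₂ - l₅)) := ⟨_, rfl⟩
  rw [← hR, ← hP, hΔ] at key
  have hR0 : R ≠ 0 := by
    have hσ : ∀ y : L, y ≠ 0 → σ y ≠ 0 := fun y hy => by simpa using hy
    have e0 : l₁ - l₀ ≠ 0 := sub_ne_zero.2 hl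
    have e1 := hσ _ e0
    have e2 := hσ _ e1
    have e3 := hσ _ e2
    have e4 := hσ _ e3
    have e5 := hσ _ e4
    simp only [map_sub, s₀, s₁, s₂, s₃, s₄, s₅] at e1 e2 e3 e4 e5
    rw [hR]
    positivity
  have hσR : σ R = R := by
    rw [hR]
    simp only [map_mul, map_sub, s₀, s₁, s₂, s₃, s₄, s₅]
    ring
  have hσP : σ P = -P := by
    rw [hP]
    simp only [map_mul, map_sub, map_add, s₀, s₁, s₂, s₃, s₄, s₅]
    ring
  have hsq : P ^ 2 = (c * R) ^ 2 := by rw [← key]; ring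
  have hP0 : P = 0 := by
    have h : σ P = P := by
      rcases sq_eq_sq_iff_eq_or_eq_neg.1 hsq with h | h <;> rw [h] <;> simp [hσR, hc]
    rw [hσP] at h
    exact (mul_eq_zero.1 (show 2 * P = 0 by linear_combination -h)).resolve_left h2
  rw [hP0] at hsq
  exact mul_ne_zero hc0 hR0 (pow_eq_zero_iff two_ne_zero |>.1 (by rw [← hsq]; ring))

/-- If `l x` and `x` have the same ratio `(b σ x + σ⁴ x) / x` and `σ l ≠ l`, then the conjugates of
`l` have cross-ratio `n = b σ³ b`; this is impossible when `normDisc` is a nonzero `σ`-fixed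
square. -/
theorem frobenius_eq_self_of_ratio_eq (h6 : ∀ x, σ (σ (σ (σ (σ (σ x))))) = x) (h2 : (2 : L) ≠ 0)
    {b x l n c : L}
    (hn : n = b * σ (σ (σ b))) (hx : x ≠ 0)
    (hl : b * σ x * (σ l - l) + σ (σ (σ (σ x))) * (σ (σ (σ (σ l))) - l) = 0)
    (hc : σ c = c) (hc0 : c ≠ 0) (hΔ : normDisc n (σ n) (σ (σ n)) = c ^ 2) : σ l = l := by
  by_contra hne
  have hx' : σ x * σ (σ (σ (σ x))) ≠ 0 := by simp [hx]
  have hl3 := congrArg (fun y => σ (σ (σ y))) hl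
  simp only [map_add, map_mul, map_sub, map_zero, h6] at hl3
  -- The hypothesis and its image under `σ³` are two linear equations for `(σ x, σ⁴ x)`; comparing
  -- them eliminates `x`.
  have h₀ : n * ((σ l - l) * (σ (σ (σ (σ l))) - σ (σ (σ l)))) =
      (σ (σ (σ (σ l))) - l) * (σ l - σ (σ (σ l))) := by
    apply mul_left_cancel₀ hx'
    rw [hn]
    linear_combination (σ (σ (σ b)) * (σ (σ (σ (σ l))) - σ (σ (σ l))) * σ (σ (σ (σ x)))) * hl -
      (σ (σ (σ (σ l))) - l) * σ (σ (σ (σ x))) * hl3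
  have h₁ := congrArg σ h₀
  have h₂ := congrArg σ h₁
  simp only [map_mul, map_sub, h6] at h₁ h₂
  exact normDisc_ne_sq_of_crossRatio σ h2 rfl rfl rfl rfl rfl (h6 l) h₀ h₁ h₂ hne hc hc0 hΔ

/-- If the discriminant has a square root negated by `σ`, there is a multiplier `m` for which
`b σ x + σ⁴ x - m x` has a kernel of dimension at least two, in the form of two equations.
They express that the semilinear system in `(x, σ³ x)` equivalent to `b σ x + σ⁴ x = m x`
closes up after three steps. Taking `σ³ m / m = σ² b σ³ b t` reduces the system to the Möbius
relation between `t` and `σ t`, solved by `discRoot`, and a normalisation of `m` by a `σ³`-fixed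
factor. The hypotheses `h90` and `hnorm` are Hilbert 90 for `σ³` and the surjectivity of the norm
from the fixed field of `σ³` to that of `σ`. -/
theorem exists_multiplier (h6 : ∀ x, σ (σ (σ (σ (σ (σ x))))) = x) (h2 : (2 : L) ≠ 0)
    (h90 : ∀ u, u * σ (σ (σ u)) = 1 → ∃ m, m ≠ 0 ∧ σ (σ (σ m)) = u * m)
    (hnorm : ∀ r, r ≠ 0 → σ r = r → ∃ k, σ (σ (σ k)) = k ∧ k * σ k * σ (σ k) = r)
    {b n δ : L} (hb : b ≠ 0) (hn : n = b * σ (σ (σ b))) (hn1 : n ≠ 1) (hδ : σ δ = -δ)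
    (hΔ : δ ^ 2 = normDisc n (σ n) (σ (σ n))) :
    ∃ m, m * σ (σ m) * (σ (σ (σ b)) * σ (σ (σ (σ b))) * σ m + σ (σ (σ (σ m)))) =
        (n - 1) * (σ n - 1) ∧
      σ (σ m) * σ (σ (σ m)) * (σ (σ (σ (σ b))) * σ m + b * σ (σ (σ (σ m)))) =
        -((n - 1) * (σ n - 1) * σ (σ b)) := by
  have hn3 : σ (σ (σ n)) = n := by simp only [hn, map_mul, h6]; ring
  have hb' : ∀ y : L, y ≠ 0 → σ y ≠ 0 := fun y hy => by simpa using hy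
  have hn0 : n ≠ 0 := by rw [hn]; exact mul_ne_zero hb (hb' _ (hb' _ (hb' _ hb)))
  have hs : ∀ y : L, 1 - y ≠ 0 → 1 - σ y ≠ 0 := fun y hy => by
    have := hb' _ hy
    rwa [map_sub, map_one] at this
  have d0 : 1 - n ≠ 0 := sub_ne_zero.2 hn1.symm
  have d1 := hs _ d0
  have d2 := hs _ d1
  have n1 := hb' _ hn0
  have n2 := hb' _ n1
  have rel := discRoot_moebius h2 hn0 n1 n2 d1 d2 hΔ
  have mul := mul_discRoot_mul_discRoot_neg h2 hn0 n2 d1 hΔ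
  have fixed := discRoot_frobenius_quotient h2 hn0 n1 n2 d0 d1 d2 hΔ
  set t := discRoot n (σ n) (σ (σ n)) δ with ht
  have ht1 : σ t = discRoot (σ n) (σ (σ n)) n (-δ) := by
    rw [ht]; simp [discRoot, hn3, hδ, map_ofNat σ 2]
  have ht2 : σ (σ t) = discRoot (σ (σ n)) n (σ n) δ := by
    rw [ht1]; simp [discRoot, hn3, hδ, map_ofNat σ 2]
  have ht3 : σ (σ (σ t)) = discRoot n (σ n) (σ (σ n)) (-δ) := by
    rw [ht2]; simp [discRoot, hn3, hδ, map_ofNat σ 2]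
  rw [← ht1] at rel fixed
  rw [← ht2] at fixed
  rw [← ht3] at mul
  obtain ⟨m, hm0, hm⟩ := h90 (σ (σ b) * σ (σ (σ b)) * t) (by
    rw [← mul, hn]; simp only [map_mul, h6]; ring)
  have ht0 : t ≠ 0 := by rintro h; simp [h] at mul
  -- If `t = -1`, then `σ t = -1` and the Möbius relation forces `n = 1`.
  have ht1' : 1 + σ t ≠ 0 := by
    have h1 : 1 + t ≠ 0 := by
      intro h
      have e : t = -1 := by linear_combination h
      have e' : σ t = -1 := by rw [e]; simp
      rw [e', e] at rel
      apply d0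
      linear_combination -rel
    have := hb' _ h1
    rwa [map_add, map_one] at this
  set b1 := σ b with hb1
  set b2 := σ b1 with hb2
  set b3 := σ b2 with hb3
  set b4 := σ b3 with hb4
  set b5 := σ b4 with hb5
  set m1 := σ m with hm1
  set m2 := σ m1 with hm2
  have hm4 : σ (σ (σ m1)) = b3 * b4 * σ t * m1 := by
    have := congrArg σ hm
    simpa only [map_mul] using this
  have nz2 : b2 ≠ 0 := hb' _ (hb' _ hb)
  have nz3 : b3 ≠ 0 := hb' _ nz2
  have nz4 : b4 ≠ 0 := hb' _ nz3
  have nm1 : m1 ≠ 0 := hb' _ hm0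
  have nm2 : m2 ≠ 0 := hb' _ nm1
  have hσn2 : σ (σ n) = b2 * b5 := by rw [hn, map_mul, map_mul]
  have hc0 : n - 1 ≠ 0 := sub_ne_zero.2 hn1
  have hc1 : σ n - 1 ≠ 0 := fun h => d1 (by linear_combination -h)
  -- The first equation for `k * m`, where `σ³ k = k`, reads `k σ k σ² k p = (n - 1) (σ n - 1)`.
  set p := m * m1 * m2 * b3 * b4 * (1 + σ t) with hp
  have hp0 : p ≠ 0 := by positivity
  have hσp : σ p = m1 * m2 * (b2 * b3 * t * m) * b4 * b5 * (1 + σ (σ t)) := by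
    rw [hp]; simp only [map_mul, map_add, map_one]; rw [← hm]
  obtain ⟨k, hk3, hk⟩ := hnorm ((n - 1) * (σ n - 1) / p) (by positivity) (by
    rw [map_div₀, hσp, map_mul, map_sub, map_sub, map_one,
      div_eq_div_iff (by rw [← hσp]; exact hb' _ hp0) hp0, hp]
    rw [hσn2] at fixed ⊢
    linear_combination -(σ n - 1) * m * m1 * m2 * b3 * b4 * fixed)
  have hk' : k * σ k * σ (σ k) * p = (n - 1) * (σ n - 1) := by rw [hk]; field_simp
  refine ⟨k * m, ?_, ?_⟩
  · simp only [map_mul, hk3]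
    rw [← hm1, ← hm2, ← hk', hm4, hp]
    ring
  · simp only [map_mul, hk3]
    rw [← hm1, ← hm2, ← hk', hm4, hm, hp]
    rw [hn] at rel
    linear_combination (k * σ k * σ (σ k) * m * m1 * m2 * b2 * b3 * b4) * rel

/-- For a multiplier `m` as in `exists_multiplier`, the values `y` of `b σ x + σ⁴ x - m x` satisfy
an equation involving only `y, σ y, …, σ⁴ y`. It is obtained by iterating the inhomogeneous system
for `(x, σ³ x)` three times and taking the combination of the two coordinates in which `σ⁵ y` does
not occur. -/
theorem annihilator_of_multiplier (h6 : ∀ x, σ (σ (σ (σ (σ (σ x))))) = x) {b n m : L}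
    (hn : n = b * σ (σ (σ b)))
    (h1 : m * σ (σ m) * (σ (σ (σ b)) * σ (σ (σ (σ b))) * σ m + σ (σ (σ (σ m)))) =
        (n - 1) * (σ n - 1))
    (h2 : σ (σ m) * σ (σ (σ m)) * (σ (σ (σ (σ b))) * σ m + b * σ (σ (σ (σ m)))) =
        -((n - 1) * (σ n - 1) * σ (σ b))) (x y : L)
    (hy : y = b * σ x + σ (σ (σ (σ x))) - m * x) :
    (n - 1) * (σ n - 1) * σ (σ y) +
      σ (σ m) * ((σ (σ (σ b)) * σ (σ (σ (σ b))) * σ m + σ (σ (σ (σ m)))) * y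
        + σ (σ (σ (σ b))) * (n - 1) * σ y
        - (σ (σ (σ (σ b))) * σ m + b * σ (σ (σ (σ m)))) * σ (σ (σ y))
        - (n - 1) * σ (σ (σ (σ y)))) = 0 := by
  subst hn
  simp only [hy, map_mul, map_sub, map_add, h6] at h1 h2 ⊢
  linear_combination (-x) * h1 + σ (σ (σ x)) * h2

end

/-! ### Finite fields and the scattered property -/

theorem FiniteField.exists_pow_eq_of_pow_eq_one {F : Type*} [Field F] [Finite F] {d k : ℕ}
    (hdk : d * k = Nat.card F - 1) {z : F} (hz : z ^ k = 1) : ∃ w : F, w ≠ 0 ∧ w ^ d = z := by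
  have hpos : 0 < Nat.card F - 1 := Nat.sub_pos_of_lt Finite.one_lt_card
  have hk : 0 < k := Nat.pos_of_mul_pos_left (hdk ▸ hpos)
  have hz0 : z ≠ 0 := by
    rintro rfl
    simp [hk.ne'] at hz
  obtain ⟨g, hg⟩ := IsCyclic.exists_ofOrder_eq_natCard (α := Fˣ)
  have htop : Subgroup.zpowers g = ⊤ :=
    Subgroup.eq_top_of_card_eq _ (by rw [Nat.card_zpowers, hg])
  obtain ⟨j, hj⟩ := mem_powers_iff_mem_zpowers.2
    (htop ▸ Subgroup.mem_top (Units.mk0 z hz0) : Units.mk0 z hz0 ∈ Subgroup.zpowers g)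
  have hj' : g ^ j = Units.mk0 z hz0 := hj
  have hdvd : d * k ∣ j * k := by
    rw [hdk, ← Nat.card_units, ← hg, orderOf_dvd_iff_pow_eq_one, pow_mul, hj']
    ext
    simpa using hz
  obtain ⟨i, rfl⟩ := Nat.dvd_of_mul_dvd_mul_right hk hdvd
  refine ⟨(g ^ i : Fˣ), Units.ne_zero _, ?_⟩
  rw [← Units.val_pow_eq_pow_val, ← pow_mul, mul_comm i d, hj', Units.val_mk0]

section
variable {K L : Type*} [Field K] [Fintype K] [Field L] [Algebra K L]

/-- The elements of an extension of `K` fixed by the `|K|`-power map lie in `K`. -/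
theorem FiniteField.exists_algebraMap_eq_of_pow_card_eq {x : L} (hx : x ^ Fintype.card K = x) :
    ∃ d : K, algebraMap K L d = x := by
  have h : (Polynomial.X ^ Fintype.card K - Polynomial.X : Polynomial K) =
      ∏ a : K, (Polynomial.X - Polynomial.C a) := by
    have hm : (Polynomial.X ^ Fintype.card K - Polynomial.X : Polynomial K).Monic :=
      Polynomial.monic_X_pow_sub (by
        rw [Polynomial.degree_X]; exact_mod_cast Fintype.one_lt_card)
    have := Polynomial.prod_multiset_X_sub_C_of_monic_of_roots_card_eq hm (by
      rw [FiniteField.roots_X_pow_card_sub_X,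
        FiniteField.X_pow_card_sub_X_natDegree_eq K Fintype.one_lt_card]
      rfl)
    rw [FiniteField.roots_X_pow_card_sub_X] at this
    exact this.symm
  have h' := congrArg (Polynomial.aeval x) h
  simp only [map_sub, map_pow, Polynomial.aeval_X, map_prod, Polynomial.aeval_C, hx,
    sub_self] at h'
  obtain ⟨a, -, ha⟩ := Finset.prod_eq_zero_iff.1 h'.symm
  exact ⟨a, (sub_eq_zero.1 ha).symm⟩

/-- A `K`-linear endomorphism of `L` whose values are roots of a nonzero `q`-polynomial of
`q`-degree at most `k` has rank at most `k`, because its range has at most `q ^ k` elements. -/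
theorem LinearMap.finrank_le_of_annihilator [FiniteDimensional K L] (F : L →ₗ[K] L) {k : ℕ}
    {a : Fin (k + 1) → L} (ha : a ≠ 0)
    (h : ∀ x, ∑ i, a i * F x ^ Fintype.card K ^ (i : ℕ) = 0) :
    Module.finrank K L ≤ k + Module.finrank K (LinearMap.ker F) := by
  classical
  have : Finite L := Module.finite_of_finite K
  have := Fintype.ofFinite L
  set P : Polynomial L := ∑ i, Polynomial.C (a i) * Polynomial.X ^ Fintype.card K ^ (i : ℕ)
    with hPdef
  have hP : P ≠ 0 := by
    obtain ⟨j, hj⟩ := Function.ne_iff.1 ha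
    intro h0
    apply hj
    have := congrArg (fun p => p.coeff (Fintype.card K ^ (j : ℕ))) h0
    simpa [hPdef, Polynomial.finsetSum_coeff, Polynomial.coeff_C_mul, Polynomial.coeff_X_pow,
      Nat.pow_right_inj Fintype.one_lt_card, ← Fin.ext_iff] using this
  have hdeg : P.natDegree ≤ Fintype.card K ^ k :=
    Polynomial.natDegree_sum_le_of_forall_le _ _ fun i _ =>
      (Polynomial.natDegree_C_mul_X_pow_le _ _).trans
        (Nat.pow_le_pow_right Fintype.card_pos (Nat.le_of_lt_succ i.2))
  have hcard : Nat.card (LinearMap.range F) ≤ Fintype.card K ^ k := by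
    have := Polynomial.card_le_degree_of_subset_roots (p := P)
      (Z := (Set.range F).toFinset) (by
        intro y hy
        obtain ⟨x, rfl⟩ := by simpa using hy
        exact (Polynomial.mem_roots hP).2 (by
          simpa [hPdef, Polynomial.IsRoot, Polynomial.eval_finsetSum] using h x))
    rw [Set.toFinset_card, ← Nat.card_eq_fintype_card] at this
    exact this.trans hdeg
  rw [Module.natCard_eq_pow_finrank (K := K), Nat.card_eq_fintype_card] at hcard
  have := (Nat.pow_le_pow_iff_right Fintype.one_lt_card).1 hcard
  have := LinearMap.finrank_range_add_finrank_ker F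
  omega

theorem finrank_subspaceU [FiniteDimensional K L] (b : L) :
    Module.finrank K (subspaceU K b) = Module.finrank K L := by
  refine LinearEquiv.finrank_eq
    (LinearEquiv.ofBijective ((LinearMap.fst K L L).domRestrict (subspaceU K b)) ⟨?_, ?_⟩)
  · rintro ⟨_, x, rfl⟩ ⟨_, y, rfl⟩ h
    obtain rfl : x = y := h
    rfl
  · exact fun x => ⟨⟨_, x, rfl⟩, rfl⟩

/-- The subspace `U_b` is scattered if and only if two nonzero elements `x` and `l x` of `L` with
the same ratio `(b x^q + x^(q^4)) / x` always differ by a factor in `K`. -/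
theorem isScattered_subspaceU_iff (b : L) :
    IsScattered K L (subspaceU K b) ↔ ∀ x l : L, x ≠ 0 →
      b * (l * x) ^ Fintype.card K + (l * x) ^ Fintype.card K ^ 4 =
        l * (b * x ^ Fintype.card K + x ^ Fintype.card K ^ 4) → l ^ Fintype.card K = l := by
  constructor
  · intro hU x l hx h
    have hne : ((x, b * x ^ Fintype.card K + x ^ Fintype.card K ^ 4) : L × L) ≠ 0 := by
      simp [Prod.ext_iff, hx]
    have hr := hU _ ⟨_, hne, rfl⟩
    obtain ⟨⟨w, hwU⟩, hw⟩ := rank_le_one_iff.1 hr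
    obtain ⟨r, hr⟩ := hw ⟨_, ⟨x, rfl⟩, Submodule.mem_span_singleton_self _⟩
    obtain ⟨s, hs⟩ := hw ⟨_, ⟨l * x, rfl⟩, Submodule.mem_span_singleton.2 ⟨l, by
      simp [h]⟩⟩
    have hr1 : r • w.1 = x := congrArg (fun p => p.1.1) hr
    have hs1 : s • w.1 = l * x := congrArg (fun p => p.1.1) hs
    have hw0 : w.1 ≠ 0 := by rintro h0; rw [h0, smul_zero] at hr1; exact hx hr1.symm
    have hr0 : r ≠ 0 := by rintro rfl; rw [zero_smul] at hr1; exact hx hr1.symm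
    have hl : l = algebraMap K L (s / r) := by
      rw [map_div₀, eq_div_iff (by simpa using hr0)]
      apply mul_right_cancel₀ hw0
      rw [mul_assoc, ← Algebra.smul_def, ← Algebra.smul_def, hr1, hs1]
    rw [hl, ← map_pow, FiniteField.pow_card]
  · rintro H _ ⟨v, -, rfl⟩
    rw [rank_le_one_iff]
    by_cases hbot : ∃ p : ↥(subspaceU K b ⊓ (Submodule.span L {v}).restrictScalars K), p ≠ 0
    · obtain ⟨p, hp⟩ := hbot
      refine ⟨p, fun p' => ?_⟩
      obtain ⟨_, ⟨x, rfl⟩, hx⟩ := p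
      obtain ⟨_, ⟨y, rfl⟩, hy⟩ := p'
      have hx0 : x ≠ 0 := by
        rintro rfl
        exact hp (Subtype.ext (by simp [Fintype.card_ne_zero, Prod.ext_iff]))
      obtain ⟨r, hr⟩ := Submodule.mem_span_singleton.1 hx
      obtain ⟨s, hs⟩ := Submodule.mem_span_singleton.1 hy
      rw [Prod.ext_iff] at hr hs
      simp only [Prod.smul_fst, Prod.smul_snd, smul_eq_mul] at hr hs
      have hr0 : r ≠ 0 := by rintro rfl; apply hx0; rw [← hr.1, zero_mul]
      have hyx : y = s / r * x := by rw [← hr.1, ← hs.1]; field_simp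
      obtain ⟨d, hd⟩ := FiniteField.exists_algebraMap_eq_of_pow_card_eq (H x (s / r) hx0 (by
        rw [← hyx, ← hr.2, ← hs.2]; field_simp))
      have hdx : d • x = y := by rw [hyx, Algebra.smul_def, hd]
      refine ⟨d, Subtype.ext (Prod.ext hdx ?_)⟩
      change d • (b * x ^ Fintype.card K + x ^ Fintype.card K ^ 4) =
        b * y ^ Fintype.card K + y ^ Fintype.card K ^ 4
      rw [Algebra.smul_def, hd, ← hr.2, ← hs.2]
      field_simp
    · push Not at hbot
      exact ⟨0, fun p => ⟨0, by rw [hbot p, smul_zero]⟩⟩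

theorem isMaximumScattered_subspaceU_iff [FiniteDimensional K L] (b : L) :
    IsMaximumScattered K L (subspaceU K b) ↔ IsScattered K L (subspaceU K b) := by
  rw [IsMaximumScattered, finrank_subspaceU, Module.finrank_prod, and_iff_left (two_mul _)]

/-- The `K`-linear map `x ↦ b x^q + x^(q^4) - m x`, whose kernel is the set of `x` for which the
point `(x, b x^q + x^(q^4))` of `U_b` lies on the line spanned by `(1, m)`. -/
def ratioMap (K : Type*) {L : Type*} [Field K] [Fintype K] [Field L] [Algebra K L] (b m : L) :
    L →ₗ[K] L :=
  LinearMap.mulLeft K b ∘ₗ (FiniteField.frobeniusAlgHom K L).toLinearMap +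
    (FiniteField.frobeniusAlgHom K L ^ 4).toLinearMap - LinearMap.mulLeft K m

theorem ratioMap_apply (b m x : L) :
    ratioMap K b m x = b * x ^ Fintype.card K + x ^ Fintype.card K ^ 4 - m * x := by
  simp [ratioMap, FiniteField.coe_frobeniusAlgHom, ← pow_mul, pow_succ]

/-- If the values of `x ↦ b x^q + x^(q^4) - m x` are roots of a nonzero `q`-polynomial of
`q`-degree at most four, then this map on the six-dimensional space `L` has a kernel of dimension
at least two, so that the line spanned by `(1, m)` meets `U_b` in dimension at least two. -/
theorem not_isScattered_of_annihilator (hdim : Module.finrank K L = 6) (b m : L) {a : Fin 5 → L}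
    (ha : a ≠ 0) (h : ∀ x, ∑ i, a i *
      (b * x ^ Fintype.card K + x ^ Fintype.card K ^ 4 - m * x) ^ Fintype.card K ^ (i : ℕ) = 0) :
    ¬ IsScattered K L (subspaceU K b) := by
  intro hU
  rw [isScattered_subspaceU_iff] at hU
  have : FiniteDimensional K L := Module.finite_of_finrank_pos (by omega)
  have hker := LinearMap.finrank_le_of_annihilator (ratioMap K b m) (k := 4) ha
    (by simpa only [ratioMap_apply] using h)
  have hle : Module.finrank K (LinearMap.ker (ratioMap K b m)) ≤ 1 := by
    by_cases hbot : ∃ p : LinearMap.ker (ratioMap K b m), p ≠ 0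
    · obtain ⟨⟨x, hx⟩, hp⟩ := hbot
      have hx0 : x ≠ 0 := fun h => hp (Subtype.ext h)
      refine finrank_le_one ⟨x, hx⟩ fun ⟨y, hy⟩ => ?_
      rw [LinearMap.mem_ker, ratioMap_apply, sub_eq_zero] at hx hy
      obtain ⟨d, hd⟩ := FiniteField.exists_algebraMap_eq_of_pow_card_eq (hU x (y / x) hx0 (by
        rw [hx, div_mul_cancel₀ _ hx0, hy]; field_simp))
      refine ⟨d, Subtype.ext ?_⟩
      change d • x = y
      rw [Algebra.smul_def, hd, div_mul_cancel₀ _ hx0]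
    · push Not at hbot
      exact finrank_le_one 0 fun p => ⟨0, by rw [hbot p, smul_zero]⟩
  omega

/-! ### The polynomial and its discriminant -/

theorem FiniteField.two_ne_zero_of_odd_card (hodd : Odd (Fintype.card K)) : (2 : L) ≠ 0 := by
  intro h
  have h' : (2 : K) = 0 := (algebraMap K L).injective (by rw [map_ofNat, map_zero, h])
  have hdvd : ringChar K ∣ 2 := ringChar.dvd (by exact_mod_cast h')
  have hchar := ((Nat.dvd_prime Nat.prime_two).1 hdvd).resolve_left CharP.ringChar_ne_one
  exact Nat.not_even_iff_odd.2 hodd (Nat.even_iff.2 (FiniteField.even_card_iff_char_two.1 hchar))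

theorem deltaB_eq_normDisc (q : ℕ) (b : L) :
    deltaB q b = normDisc (normB q b) (normB q b ^ q) ((normB q b ^ q) ^ q) := by
  unfold deltaB normDisc
  ring

theorem Polynomial.discr_quadratic {a b c : L} (ha : a ≠ 0) :
    (C a * X ^ 2 + C b * X + C c : Polynomial L).discr = b ^ 2 - 4 * a * c := by
  rw [discr_of_degree_eq_two (degree_quadratic ha)]
  simp only [coeff_add, coeff_C_mul, coeff_X_pow, coeff_X, coeff_C]
  norm_num
  ring

theorem phiPoly_discr (K : Type*) {L : Type*} [Field K] [Fintype K] [Field L] [Algebra K L]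
    {b : L} (hb : b ≠ 0) :
    (phiPoly (Fintype.card K) b).natDegree = 2 ∧
      (phiPoly (Fintype.card K) b).discr = deltaB (Fintype.card K) b := by
  have hsub : ∀ y : L, (y - 1) ^ Fintype.card K = y ^ Fintype.card K - 1 := fun y => by
    simpa using map_sub (FiniteField.frobeniusAlgHom K L) y 1
  generalize Fintype.card K = q at hsub ⊢
  have ha : b ^ (q + 1) ≠ 0 := pow_ne_zero _ hb
  have hphi : phiPoly q b = Polynomial.C (b ^ (q + 1)) * Polynomial.X ^ 2 +
      Polynomial.C (-b ^ (q ^ 5 + q ^ 4 + q ^ 3 + q ^ 2 + q + 1)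
        + 2 * b ^ (q ^ 4 + q ^ 3 + q + 1) - b ^ (q ^ 3 + 1) - b ^ (q ^ 4 + q)
        + b ^ (q ^ 5 + q ^ 2)) * Polynomial.X +
      Polynomial.C (-(b ^ (q ^ 3 + q ^ 4) * (b ^ (q ^ 3 + 1) - 1) ^ (1 + q + q ^ 2))) := by
    rw [phiPoly, Polynomial.C_neg, sub_eq_add_neg]
  rw [hphi]
  refine ⟨Polynomial.natDegree_quadratic ha, ?_⟩
  rw [Polynomial.discr_quadratic ha, deltaB_eq_normDisc, normDisc]
  have e₁ : b ^ (q ^ 4 + q) = normB q b ^ q := by rw [normB]; ring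
  have e₂ : b ^ (q ^ 5 + q ^ 2) = (normB q b ^ q) ^ q := by rw [normB]; ring
  have e₃ : b ^ (q ^ 5 + q ^ 4 + q ^ 3 + q ^ 2 + q + 1) =
      normB q b * normB q b ^ q * (normB q b ^ q) ^ q := by rw [← e₂, ← e₁, normB]; ring
  have e₄ : b ^ (q ^ 4 + q ^ 3 + q + 1) = normB q b * normB q b ^ q := by
    rw [← e₁, normB]; ring
  have e₅ : (b ^ (q ^ 3 + 1) - 1) ^ (1 + q + q ^ 2) =
      (normB q b - 1) * (normB q b ^ q - 1) * ((normB q b ^ q) ^ q - 1) := by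
    rw [← hsub, ← hsub, ← hsub, normB]; ring
  have e₆ : b ^ (q + 1) * b ^ (q ^ 3 + q ^ 4) = normB q b * normB q b ^ q := by
    rw [← e₁, normB]; ring
  rw [e₁, e₂, e₃, e₄, e₅, show b ^ (q ^ 3 + 1) = normB q b from rfl]
  linear_combination 4 * (normB q b - 1) * (normB q b ^ q - 1) * ((normB q b ^ q) ^ q - 1) * e₆

/-! ### Norms and square roots in the extension of degree six -/

theorem card_eq_pow_six (hdim : Module.finrank K L = 6) : Nat.card L = Fintype.card K ^ 6 := by
  have : FiniteDimensional K L := Module.finite_of_finrank_pos (by omega)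
  rw [Module.natCard_eq_pow_finrank (K := K), hdim, Nat.card_eq_fintype_card]

/-- Hilbert 90 for the quadratic extension `L` of the fixed field of `x ↦ x^(q^3)`. -/
theorem exists_cube_frobenius_eq_mul (hdim : Module.finrank K L = 6) {u : L}
    (hu : u * u ^ Fintype.card K ^ 3 = 1) : ∃ m : L, m ≠ 0 ∧ m ^ Fintype.card K ^ 3 = u * m := by
  have : FiniteDimensional K L := Module.finite_of_finrank_pos (by omega)
  have : Finite L := Module.finite_of_finite K
  have hcard := card_eq_pow_six hdim
  have hq : 1 ≤ Fintype.card K ^ 3 := Nat.one_le_pow _ _ Fintype.card_pos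
  obtain ⟨m, hm0, hm⟩ := FiniteField.exists_pow_eq_of_pow_eq_one
    (d := Fintype.card K ^ 3 - 1) (k := Fintype.card K ^ 3 + 1) (z := u)
    (by rw [hcard, mul_comm, ← Nat.sq_sub_sq _ 1]; ring_nf) (by rw [pow_succ', hu])
  refine ⟨m, hm0, ?_⟩
  rw [← hm, ← pow_succ, Nat.sub_add_cancel hq]

/-- Surjectivity of the norm from `L` to `K`, whose value at `w` is `w ^ (1 + q + ⋯ + q^5)`. -/
theorem exists_pow_geom_sum_eq (hdim : Module.finrank K L = 6) {r : L} (hr0 : r ≠ 0)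
    (hr : r ^ Fintype.card K = r) :
    ∃ w : L, w ^ ∑ i ∈ Finset.range 6, Fintype.card K ^ i = r := by
  have : FiniteDimensional K L := Module.finite_of_finrank_pos (by omega)
  have : Finite L := Module.finite_of_finite K
  obtain ⟨w, -, hw⟩ := FiniteField.exists_pow_eq_of_pow_eq_one
    (d := ∑ i ∈ Finset.range 6, Fintype.card K ^ i) (k := Fintype.card K - 1) (z := r)
    (by
      obtain ⟨t, ht⟩ := Nat.exists_eq_succ_of_ne_zero (Fintype.card_ne_zero (α := K))
      rw [card_eq_pow_six hdim, ht]
      refine (Nat.sub_eq_of_eq_add ?_).symm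
      simp only [Finset.sum_range_succ, Finset.sum_range_zero, Nat.succ_eq_add_one,
        Nat.add_sub_cancel]
      ring)
    (mul_right_cancel₀ hr0 (by
      rw [← pow_succ, Nat.sub_add_cancel Fintype.card_pos, hr, one_mul]))
  exact ⟨w, hw⟩

/-- Surjectivity of the norm from the fixed field of `x ↦ x^(q^3)` to `K`. -/
theorem exists_mul_frobenius_mul_frobenius_sq_eq (hdim : Module.finrank K L = 6) {r : L}
    (hr0 : r ≠ 0) (hr : r ^ Fintype.card K = r) :
    ∃ k : L, k ^ Fintype.card K ^ 3 = k ∧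
      k * k ^ Fintype.card K * k ^ Fintype.card K ^ 2 = r := by
  obtain ⟨w, hw⟩ := exists_pow_geom_sum_eq hdim hr0 hr
  have : FiniteDimensional K L := Module.finite_of_finrank_pos (by omega)
  have : Finite L := Module.finite_of_finite K
  have := Fintype.ofFinite L
  have hw6 : w ^ Fintype.card K ^ 6 = w := by
    rw [← card_eq_pow_six hdim, Nat.card_eq_fintype_card, FiniteField.pow_card]
  refine ⟨w ^ (Fintype.card K ^ 3 + 1), ?_, ?_⟩
  · calc _ = w ^ Fintype.card K ^ 6 * w ^ Fintype.card K ^ 3 := by ring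
      _ = _ := by rw [hw6]; ring
  · rw [← hw]
    simp only [Finset.sum_range_succ, Finset.sum_range_zero]
    ring

/-- An element of `K` that is zero or a nonsquare has a square root in `L` negated by the
`|K|`-power map. -/
theorem exists_sq_eq_of_not_isSquare (hodd : Odd (Fintype.card K))
    (hdim : Module.finrank K L = 6) {d : K} (hd : d ≠ 0 → ¬ IsSquare d) :
    ∃ δ : L, δ ^ 2 = algebraMap K L d ∧ δ ^ Fintype.card K = -δ := by
  by_cases hd0 : d = 0
  · exact ⟨0, by simp [hd0], by simp [Fintype.card_ne_zero]⟩
  have hdq : algebraMap K L d ^ Fintype.card K = algebraMap K L d := by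
    rw [← map_pow, FiniteField.pow_card]
  obtain ⟨w, hw⟩ := exists_pow_geom_sum_eq hdim (by simpa using hd0) hdq
  -- The number of summands is even, and each is odd.
  have heven : Even (∑ i ∈ Finset.range 6, Fintype.card K ^ i) := by
    obtain ⟨k, hk⟩ := hodd
    refine ⟨3 + 15 * k + 40 * k ^ 2 + 60 * k ^ 3 + 48 * k ^ 4 + 16 * k ^ 5, ?_⟩
    simp only [Finset.sum_range_succ, Finset.sum_range_zero, hk]
    ring
  obtain ⟨j, hj⟩ := heven
  have hδ : (w ^ j) ^ 2 = algebraMap K L d := by rw [← hw, hj]; ring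
  refine ⟨w ^ j, hδ, ?_⟩
  refine (sq_eq_sq_iff_eq_or_eq_neg.1
    (?_ : ((w ^ j) ^ Fintype.card K) ^ 2 = (w ^ j) ^ 2)).resolve_left ?_
  · rw [← pow_mul, mul_comm, pow_mul, hδ, hdq]
  · intro h
    obtain ⟨e, he⟩ := FiniteField.exists_algebraMap_eq_of_pow_card_eq h
    refine hd hd0 ⟨e, (algebraMap K L).injective ?_⟩
    rw [← hδ, ← he, map_mul, sq]

end

/-! ### The criterion -/

theorem mainTheorem1 (K L : Type*) [Field K] [Fintype K] [Field L] [Algebra K L]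
    (hodd : Odd (Fintype.card K)) (hdim : Module.finrank K L = 6) (b : L) (hb : b ≠ 0) :
    ((phiPoly (Fintype.card K) b).natDegree = 2 ∧
      (phiPoly (Fintype.card K) b).discr = deltaB (Fintype.card K) b) ∧
    (∃ d : K, algebraMap K L d = deltaB (Fintype.card K) b) ∧
    (IsMaximumScattered K L (subspaceU K b) ↔
      ∃ d : K, algebraMap K L d = deltaB (Fintype.card K) b ∧ d ≠ 0 ∧ IsSquare d) := by
  have : FiniteDimensional K L := Module.finite_of_finrank_pos (by omega)
  have : Finite L := Module.finite_of_finite K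
  have := Fintype.ofFinite L
  have h2 : (2 : L) ≠ 0 := FiniteField.two_ne_zero_of_odd_card hodd
  obtain ⟨σ, hσ⟩ : ∃ σ : L →+* L, ∀ x, σ x = x ^ Fintype.card K :=
    ⟨(FiniteField.frobeniusAlgHom K L : L →+* L), fun _ => rfl⟩
  have hσ2 : ∀ x, x ^ Fintype.card K ^ 2 = σ (σ x) := fun x => by simp only [hσ]; ring
  have hσ3 : ∀ x, x ^ Fintype.card K ^ 3 = σ (σ (σ x)) := fun x => by simp only [hσ]; ring
  have hσ4 : ∀ x, x ^ Fintype.card K ^ 4 = σ (σ (σ (σ x))) := fun x => by simp only [hσ]; ring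
  have h6 : ∀ x, σ (σ (σ (σ (σ (σ x))))) = x := fun x => by
    calc
      _ = x ^ Fintype.card K ^ 6 := by simp only [hσ]; ring
      _ = x := by rw [← card_eq_pow_six hdim, Nat.card_eq_fintype_card, FiniteField.pow_card]
  obtain ⟨n, hn⟩ : ∃ n, n = b * σ (σ (σ b)) := ⟨_, rfl⟩
  have hΔ : deltaB (Fintype.card K) b = normDisc n (σ n) (σ (σ n)) := by
    rw [deltaB_eq_normDisc, normB, pow_succ', hσ3, ← hn, ← hσ, ← hσ]
  have hn3 : σ (σ (σ n)) = n := by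
    rw [hn]
    simp only [map_mul, h6]
    ring
  obtain ⟨d, hd⟩ : ∃ d : K, algebraMap K L d = deltaB (Fintype.card K) b := by
    apply FiniteField.exists_algebraMap_eq_of_pow_card_eq
    rw [← hσ, hΔ]
    simp only [normDisc, map_add, map_sub, map_mul, map_pow, map_ofNat, hn3]
    ring
  refine ⟨phiPoly_discr K hb, ⟨d, hd⟩, ?_⟩
  rw [isMaximumScattered_subspaceU_iff]
  constructor
  · contrapose!
    intro hno
    obtain ⟨δ, hδ, hσδ⟩ := exists_sq_eq_of_not_isSquare (L := L) hodd hdim (hno d hd)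
    rw [← hσ] at hσδ
    rw [hd, hΔ] at hδ
    -- For `n = 1` the values `y` of `b x^q + x^(q^4)` satisfy `y^(q^3) = b^(q^3) y`.
    by_cases hn1 : n = 1
    · refine not_isScattered_of_annihilator hdim b 0
        (a := ![-σ (σ (σ b)), 0, 0, 1, 0]) (fun h => one_ne_zero (congrFun h 3)) fun x => ?_
      simp only [Fin.sum_univ_succ, Finset.univ_eq_empty, Finset.sum_empty]
      simp [hσ3, hσ4, ← hσ, h6]
      rw [hn] at hn1
      linear_combination -σ x * hn1
    · obtain ⟨m, hm₁, hm₂⟩ := exists_multiplier σ h6 h2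
        (fun u hu => by
          simp only [← hσ3] at hu ⊢
          exact exists_cube_frobenius_eq_mul hdim hu)
        (fun r hr0 hr => by
          obtain ⟨k, hk₃, hk⟩ :=
            exists_mul_frobenius_mul_frobenius_sq_eq hdim hr0 (by rwa [hσ] at hr)
          exact ⟨k, by rw [← hσ3, hk₃], by rw [← hσ2, hσ k, hk]⟩)
        hb hn hn1 hσδ hδ
      have hc : (n - 1) * (σ n - 1) ≠ 0 := by
        refine mul_ne_zero (sub_ne_zero.2 hn1) fun h => hn1 (σ.injective ?_)
        rw [map_one, sub_eq_zero.1 h]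
      refine not_isScattered_of_annihilator hdim b m
        (a := ![σ (σ m) * (σ (σ (σ b)) * σ (σ (σ (σ b))) * σ m + σ (σ (σ (σ m)))),
          σ (σ m) * (σ (σ (σ (σ b))) * (n - 1)), (n - 1) * (σ n - 1),
          -(σ (σ m) * (σ (σ (σ (σ b))) * σ m + b * σ (σ (σ (σ m))))),
          -(σ (σ m) * (n - 1))]) (fun h => hc (congrFun h 2)) fun x => ?_
      have key := annihilator_of_multiplier σ h6 hn hm₁ hm₂ x _ rfl
      simp only [Fin.sum_univ_five, hσ4, ← hσ]
      simp [hσ2, hσ3, hσ4, ← hσ] at key ⊢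
      linear_combination key
  · rintro ⟨d', hd', hd0, e, rfl⟩
    rw [isScattered_subspaceU_iff]
    intro x l hx hl
    rw [← hσ]
    refine frobenius_eq_self_of_ratio_eq σ h6 h2 (c := algebraMap K L e) hn hx ?_ ?_ ?_ ?_
    · simp only [hσ4, ← hσ, map_mul] at hl
      linear_combination hl
    · rw [hσ, ← map_pow, FiniteField.pow_card]
    · simpa using left_ne_zero_of_mul hd0
    · rw [← hΔ, ← hd', map_mul, sq]
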